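/- **Setting.** An instance consists of a hypothesis class $\mathcal F$, a measurable space $\mathcal Z$, a loss $\ell:\mathcal F\times\mathcal Z\to[0,1]$ that is measurable in its second argument, two source distributions $P_1,P_2$ and a target distribution $Q$ on $\mathcal Z$. Its source risks are $\mathcal R_k(f)=\mathbb E_{z\sim P_k}[\ell(f,z)]$ for $k=1,2$, with $\mathbf R=(\mathcal R_1,\mathcal R_2):\mathcal F\to[0,1]^2$, and its target risk is $\mathcal R_Q(f)=\mathbb E_{z\sim Q}[\ell(f,z)]$. The set $\mathbf R(\mathcal F)$ is assumed to be compact and $\mathcal R_Q$ to attain its minimum on $\mathcal F$. The excess risk is $\mathcal E(f)=\mathcal R_Q(f)-\inf_{g\in\mathcal F}\mathcal R_Q(g)$. A hypothesis $f$ is Pareto optimal if there is no $f'\in\mathcal F$ with $\mathcal R_k(f')\le\mathcal R_k(f)$ for $k=1,2$ and $\mathbf R(f')\ne\mathbf R(f)$; the Pareto front $\mathfrak R$ is the set of vectors $\mathbf R(f)$ with $f$ Pareto optimal. For $t>0$, a finite set $S\subset\mathcal F$ is a $t$-Pareto set if $\mathbf R(S)\subset\mathfrak R$ and for every $r\in\mathfrak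 R$ there is $f\in S$ with $\max_k(\mathcal R_k(f)-r_k)\le t$; it is minimal if no $t$-Pareto set has fewer elements. Given an i.i.d. sample $z_1,\dots,z_n\sim Q$, the empirical risk is $\widehat{\mathcal R}_Q(f)=\frac1n\sum_{i=1}^n\ell(f,z_i)$. Estimators are understood to be measurable functions of the sample. *Pareto ERM* at scale $t$ is an estimator $\hat f^{\mathrm{Par}}_t\in\arg\min_{f\in S}\widehat{\mathcal R}_Q(f)$, where $S$ is a (fixed) minimal $t$-Pareto set. *LMSA.* Let $\mathfrak G=\{(\theta+h\mathbb Z)\cap[0,1]:0<h\le1,\ \theta\in[0,h)\}$ be the set of uniform grids. For $\Lambda\in\mathfrak G$ fix for each $\lambda\in\Lambda$ a minimizer $f_\lambda$ of $\lambda\mathcal R_1+(1-\lambda)\mathcal R_2$ over $\mathcal F$, chosen by any tie-breaking rule that does not depend on the sample. The LMSA estimator is $\hat f^{\mathrm{LMSA}}_\Lambda\in\arg\min_{f\in\{f_\lambda:\lambda\in\Lambda\}}\widehat{\mathcal R}_Q(f)$. **Theorem (separation on mixture distributions, $K=2$).** There are universal constants $c,C>0$ such that for all sufficiently large $n\in\mathbb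 N$ there is a class $\mathcal C_n$ of instances with the following properties. (i) For every instance in $\mathcal C_n$ there is $\lambda^\star\in[0,1]$ such that $Q=\lambda^\star P_1+(1-\lambda^\star)P_2$, and hence $\mathcal R_Q(f)=\lambda^\star\mathcal R_1(f)+(1-\lambda^\star)\mathcal R_2(f)$ for all $f\in\mathcal F$. (ii) For every instance in $\mathcal C_n$, every point $r$ of the Pareto front is supported by a weighted sum of the source risks: there is $\lambda\in[0,1]$ with $\lambda r_1+(1-\lambda)r_2\le\lambda\mathcal R_1(f)+(1-\lambda)\mathcal R_2(f)$ for all $f\in\mathcal F$. (iii) Whatever the rules by which ties are broken in LMSA, $$\inf_{\Lambda\in\mathfrak G}\ \sup_{\mathcal C_n}\ \mathbb E\big[\mathcal E(\hat f^{\mathrm{LMSA}}_\Lambda)\big]\ \ge\ c\sqrt{\frac{\log n}{n}}.$$ (iv) Whatever the choices of the minimal $1/n$-Pareto sets and of the empirical risk minimizers, $$\sup_{\mathcal C_n}\ \mathbb E\big[\mathcal E(\hat f^{\mathrm{Par}}_{1/n})\big]\ \le\ \frac{C}{\sqrt n}.$$ -/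

import Mathlib

open MeasureTheory Set

noncomputable section

/-- A transfer-learning instance with two source distributions `P 0`, `P 1`, a target distribution
`Q` on the observation space `Z`, and a loss with values in `[0,1]` on the hypothesis class `F`.
The last two fields are the usual regularity conventions: the set of attainable source risk vectors
is compact, and the target risk attains its minimum (so in particular `F` is nonempty). -/
structure TransferInstance where
  F : Type
  Z : Type
  mZ : MeasurableSpace Z
  loss : F → Z → ℝ
  measurable_loss : ∀ f, Measurable (loss f)
  loss_mem : ∀ f z, loss f z ∈ Icc (0 : ℝ) 1
  P : Fin 2 → Measure Z
  Q : Measure Z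
  isProbabilityMeasure_P : ∀ k, IsProbabilityMeasure (P k)
  isProbabilityMeasure_Q : IsProbabilityMeasure Q
  isCompact_risks : IsCompact (range fun (f : F) (k : Fin 2) => ∫ z, loss f z ∂(P k))
  exists_target_minimizer : ∃ f₀, ∀ f, ∫ z, loss f₀ z ∂Q ≤ ∫ z, loss f z ∂Q

/-- The uniform grids `(θ + h ℤ) ∩ [0,1]` with width `0 < h ≤ 1` and offset `θ ∈ [0,h)`. -/
def uniformGrids : Set (Set ℝ) :=
  {Λ | ∃ h θ : ℝ, 0 < h ∧ h ≤ 1 ∧ 0 ≤ θ ∧ θ < h ∧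
    Λ = {x | ∃ m : ℤ, x = θ + h * m} ∩ Icc 0 1}

/-- The Pareto distance `d(r, r') = max_k (r_k - r'_k)` of risk vectors. -/
def paretoDist (r r' : Fin 2 → ℝ) : ℝ := max (r 0 - r' 0) (r 1 - r' 1)

/-- `S` is a `t`-Pareto cover of `A`. -/
def IsParetoCover (t : ℝ) (A S : Set (Fin 2 → ℝ)) : Prop :=
  S ⊆ A ∧ ∀ r ∈ A, ∃ r₀ ∈ S, paretoDist r₀ r ≤ t

namespace TransferInstance

attribute [instance] mZ isProbabilityMeasure_P isProbabilityMeasure_Q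

variable (I : TransferInstance)

/-- The vector of source risks. -/
def sourceRisk (f : I.F) (k : Fin 2) : ℝ := ∫ z, I.loss f z ∂(I.P k)

/-- The target risk. -/
def targetRisk (f : I.F) : ℝ := ∫ z, I.loss f z ∂I.Q

/-- The weighted sum of the source risks with weight `w` on the first source. -/
def weightedRisk (w : ℝ) (f : I.F) : ℝ := w * I.sourceRisk f 0 + (1 - w) * I.sourceRisk f 1

/-- The Pareto optimal hypotheses; `<` is the product order, i.e. `≤` in both coordinates and
not equal. -/
def paretoSet : Set I.F := {f | ¬ ∃ f', I.sourceRisk f' < I.sourceRisk f}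

/-- The Pareto front: the source risk vectors of the Pareto optimal hypotheses. -/
def paretoFront : Set (Fin 2 → ℝ) := I.sourceRisk '' I.paretoSet

/-- The risk vector `r` minimizes a weighted sum of the source risks over the hypothesis class. -/
def IsSupported (r : Fin 2 → ℝ) : Prop :=
  ∃ w ∈ Icc (0 : ℝ) 1, ∀ f, w * r 0 + (1 - w) * r 1 ≤ I.weightedRisk w f

/-- A finite set of hypotheses is a `t`-Pareto set if its risk vectors form a `t`-Pareto cover of
the Pareto front. -/
def IsParetoCoverSet (t : ℝ) (S : Finset I.F) : Prop :=
  IsParetoCover t I.paretoFront (I.sourceRisk '' (S : Set I.F))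

/-- A `t`-Pareto set of the least possible size. -/
def IsMinimalParetoCoverSet (t : ℝ) (S : Finset I.F) : Prop :=
  I.IsParetoCoverSet t S ∧ ∀ S' : Finset I.F, I.IsParetoCoverSet t S' → S.card ≤ S'.card

variable {n : ℕ}

/-- The empirical target risk on the sample `z`. -/
def empRisk (z : Fin n → I.Z) (f : I.F) : ℝ := (1 / (n : ℝ)) * ∑ i, I.loss f (z i)

/-- `fhat` is an empirical risk minimizer over the set `G` of hypotheses. It depends measurably on
the sample (this is full measurability if `G` is finite, the only case used). -/
def IsERM (G : Set I.F) (fhat : (Fin n → I.Z) → I.F) : Prop :=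
  (∀ f, MeasurableSet {z | fhat z = f}) ∧
    ∀ z, fhat z ∈ G ∧ ∀ g ∈ G, I.empRisk z (fhat z) ≤ I.empRisk z g

/-- `fhat` is the LMSA estimator with weights in `Λ`, for some way `sel` to break the ties between
minimizers of a weighted sum of the source risks. -/
def IsLMSA (Λ : Set ℝ) (fhat : (Fin n → I.Z) → I.F) : Prop :=
  ∃ sel : ℝ → I.F, (∀ w ∈ Λ, ∀ f, I.weightedRisk w (sel w) ≤ I.weightedRisk w f) ∧
    I.IsERM (sel '' Λ) fhat

/-- `fhat` is the Pareto ERM at scale `t`, for some minimal `t`-Pareto set. -/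
def IsParetoERM (t : ℝ) (fhat : (Fin n → I.Z) → I.F) : Prop :=
  ∃ S : Finset I.F, I.IsMinimalParetoCoverSet t S ∧ I.IsERM (S : Set I.F) fhat

/-- The excess target risk of `f` over the hypothesis class. -/
def excessRisk (f : I.F) : ℝ := I.targetRisk f - ⨅ g, I.targetRisk g

/-- The expected excess risk of an estimator over an i.i.d. sample of size `n` from the target. -/
def expectedExcessRisk (fhat : (Fin n → I.Z) → I.F) : ENNReal :=
  ∫⁻ z, ENNReal.ofReal (I.excessRisk (fhat z)) ∂(Measure.pi fun _ : Fin n => I.Q)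

end TransferInstance

end

/-! The class consists of three instances, all at the width `t = √(log n / n) / 3`. It exploits a
dilemma in the choice of the grid width `h`: a coarse grid misses the optimal hypothesis, and a fine
one selects too many hypotheses.

If `h ≥ t`, the grid misses one of the two weight intervals of half-width `t / 8` around `1 / 2` and
`1 / 2 + t / 2` (`grid_gap`). In the corresponding `kinkInstance`, the optimal hypothesis is
selected only by weights in that interval, so LMSA has excess risk at least `t / 32` on every sample
(`kinkInstance_expectedExcessRisk_ge`).

If `h < t`, LMSA on `clusterInstance` selects all of about `1 / (4 t)` hypotheses with nearly equal
source risks and independent noise (`clusterInstance_selects_cluster`). The largest of that many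
sums of `n` random signs exceeds `n t / 8` with probability at least `1 / 2`, by a second moment
argument for exponential moments (`measure_forall_sum_coinSign_lt`). The corresponding hypothesis
then looks better than the optimum, which costs at least `t / 64`.

Pareto ERM avoids both traps. The cluster has diameter at most `1 / n` in risk space, so at scale `1
/ n` three hypotheses always suffice for a cover (`IsEasy`). The ERM over at most three candidates
loses only `O(1 / √n)`, since the approximation error `1 / n` in the source risks passes to the
target risk of a mixture. -/

noncomputable section

/-! ### Mean deviation of an empirical average -/

open ProbabilityTheory in
/-- The variance of a mean of `n` independent copies of a `[0,1]`-valued variable is at most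
`1 / n`. -/
lemma integral_sq_average_sub_le {Z : Type*} [MeasurableSpace Z] (Q : Measure Z)
    [IsProbabilityMeasure Q] {g : Z → ℝ} (hg : Measurable g) (h01 : ∀ z, g z ∈ Icc (0 : ℝ) 1)
    {n : ℕ} (hn : 0 < n) :
    ∫ z, ((1 / (n : ℝ)) * ∑ i, g (z i) - ∫ x, g x ∂Q) ^ 2 ∂(Measure.pi fun _ : Fin n => Q)
      ≤ 1 / (n : ℝ) := by
  have hn' : (0 : ℝ) < n := by exact_mod_cast hn
  have hmem : MemLp g 2 Q := MemLp.of_bound hg.aestronglyMeasurable 1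
    (ae_of_all _ fun z => by rw [Real.norm_eq_abs, abs_le]; constructor <;> linarith [(h01 z).1, (h01 z).2])
  have hint : Integrable g Q := hmem.integrable (by norm_num)
  have hvar := variance_sum_pi (μ := fun _ : Fin n => Q) (X := fun _ => g) (fun _ => hmem)
  have hv1 : Var[g; Q] ≤ 1 := by
    have := variance_le_sq_of_bounded (μ := Q) (X := g) (a := 0) (b := 1)
      (ae_of_all _ h01) hg.aemeasurable
    norm_num at this; linarith
  have hpres (i : Fin n) := measurePreserving_eval (fun _ : Fin n => Q) i
  have hinti (i : Fin n) : Integrable (fun z : Fin n → Z => g (z i)) (Measure.pi fun _ => Q) :=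
    (hpres i).integrable_comp_of_integrable hint
  have hmean : ∫ z, (∑ i, fun z : Fin n → Z => g (z i)) z ∂(Measure.pi fun _ : Fin n => Q)
      = n * ∫ x, g x ∂Q := by
    simp only [Finset.sum_apply]
    rw [integral_finsetSum _ fun i _ => hinti i]
    have (i : Fin n) : ∫ z : Fin n → Z, g (z i) ∂(Measure.pi fun _ => Q) = ∫ x, g x ∂Q := by
      conv_rhs => rw [← (hpres i).map_eq]
      rw [integral_map (hpres i).measurable.aemeasurable
        hg.aestronglyMeasurable]
    simp [this]
  rw [variance_eq_integral (by fun_prop), hmean] at hvar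
  have key : ∀ z : Fin n → Z, ((1 / (n : ℝ)) * ∑ i, g (z i) - ∫ x, g x ∂Q) ^ 2
      = (1 / (n : ℝ) ^ 2) * ((∑ i, fun z : Fin n → Z => g (z i)) z - n * ∫ x, g x ∂Q) ^ 2 := by
    intro z
    simp only [Finset.sum_apply]
    field_simp
  simp_rw [key]
  rw [integral_const_mul, hvar]
  simp only [Finset.sum_const, Finset.card_univ, Fintype.card_fin, nsmul_eq_mul]
  calc 1 / (n : ℝ) ^ 2 * (n * Var[g; Q] : ℝ) ≤ 1 / (n : ℝ) ^ 2 * (n * 1 : ℝ) := by gcongr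
    _ = 1 / (n : ℝ) := by field_simp

/-- The second moment bound passes to the first moment by `|x| ≤ (√n / 2) x ^ 2 + 1 / (2 √n)`, which
is the inequality `(√n |x| - 1) ^ 2 ≥ 0`. -/
lemma integral_abs_average_sub_le {Z : Type*} [MeasurableSpace Z] (Q : Measure Z)
    [IsProbabilityMeasure Q] {g : Z → ℝ} (hg : Measurable g) (h01 : ∀ z, g z ∈ Icc (0 : ℝ) 1)
    {n : ℕ} (hn : 0 < n) :
    Integrable (fun z => |(1 / (n : ℝ)) * ∑ i, g (z i) - ∫ x, g x ∂Q|)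
        (Measure.pi fun _ : Fin n => Q) ∧
    ∫ z, |(1 / (n : ℝ)) * ∑ i, g (z i) - ∫ x, g x ∂Q| ∂(Measure.pi fun _ : Fin n => Q)
      ≤ 1 / √n := by
  have hn' : (0 : ℝ) < n := by exact_mod_cast hn
  have hs : 0 < √(n : ℝ) := Real.sqrt_pos.2 hn'
  have hsq := Real.sq_sqrt hn'.le
  set m := ∫ x, g x ∂Q with hm
  have hmeas : Measurable fun z : Fin n → Z => (1 / (n : ℝ)) * ∑ i, g (z i) - m := by fun_prop
  have hbd (z : Fin n → Z) : |(1 / (n : ℝ)) * ∑ i, g (z i) - m| ≤ 1 + |m| := by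
    have h0 : 0 ≤ ∑ i, g (z i) := Finset.sum_nonneg fun i _ => (h01 _).1
    have h1 : ∑ i, g (z i) ≤ n := by
      simpa using Finset.sum_le_sum (s := Finset.univ) fun i _ => (h01 (z i)).2
    refine (abs_sub _ _).trans (add_le_add ?_ le_rfl)
    rw [abs_of_nonneg (by positivity), one_div, inv_mul_le_one₀ hn']
    exact h1
  have hi1 : Integrable (fun z => |(1 / (n : ℝ)) * ∑ i, g (z i) - m|)
      (Measure.pi fun _ : Fin n => Q) :=
    Integrable.of_bound hmeas.abs.aestronglyMeasurable (1 + |m|)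
      (ae_of_all _ fun z => by simpa using hbd z)
  have hi2 : Integrable (fun z => ((1 / (n : ℝ)) * ∑ i, g (z i) - m) ^ 2)
      (Measure.pi fun _ : Fin n => Q) :=
    Integrable.of_bound (hmeas.pow_const 2).aestronglyMeasurable ((1 + |m|) ^ 2)
      (ae_of_all _ fun z => by
        rw [Real.norm_eq_abs, abs_pow]
        exact pow_le_pow_left₀ (abs_nonneg _) (hbd z) 2)
  refine ⟨hi1, ?_⟩
  calc ∫ z, |(1 / (n : ℝ)) * ∑ i, g (z i) - m| ∂(Measure.pi fun _ : Fin n => Q)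
      ≤ ∫ z, (√n / 2 * ((1 / (n : ℝ)) * ∑ i, g (z i) - m) ^ 2 + 1 / (2 * √n))
          ∂(Measure.pi fun _ : Fin n => Q) := by
        refine integral_mono hi1 ((hi2.const_mul _).add (integrable_const _)) fun z => ?_
        dsimp only
        generalize (1 / (n : ℝ)) * ∑ i, g (z i) - m = x
        have e : √(n : ℝ) / 2 * x ^ 2 + 1 / (2 * √n) - |x| = (√n * |x| - 1) ^ 2 / (2 * √n) := by
          rw [← sq_abs x]; field_simp; ring
        have : 0 ≤ (√n * |x| - 1) ^ 2 / (2 * √(n : ℝ)) := by positivity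
        linarith
    _ ≤ √n / 2 * (1 / n) + 1 / (2 * √n) := by
        rw [integral_add (hi2.const_mul _) (integrable_const _), integral_const_mul]
        simp only [integral_const, probReal_univ, smul_eq_mul, one_mul]
        gcongr
        exact integral_sq_average_sub_le Q hg h01 hn
    _ = 1 / √n := by
        have : (1 : ℝ) / n = 1 / √n ^ 2 := by rw [hsq]
        rw [this]; field_simp; norm_num

/-! ### Upper bound for Pareto ERM -/

namespace TransferInstance
variable (I : TransferInstance)

lemma integrable_loss (f : I.F) (μ : Measure I.Z) [IsFiniteMeasure μ] :
    Integrable (I.loss f) μ :=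
  Integrable.of_bound (I.measurable_loss f).aestronglyMeasurable 1
    (ae_of_all _ fun z => by
      rw [Real.norm_eq_abs, abs_le]; constructor <;> linarith [(I.loss_mem f z).1, (I.loss_mem f z).2])

lemma targetRisk_of_mixture {w : ℝ} (hw : w ∈ Icc (0 : ℝ) 1)
    (hQ : I.Q = ENNReal.ofReal w • I.P 0 + ENNReal.ofReal (1 - w) • I.P 1) (f : I.F) :
    I.targetRisk f = w * I.sourceRisk f 0 + (1 - w) * I.sourceRisk f 1 := by
  unfold targetRisk sourceRisk
  rw [hQ, integral_add_measure ((I.integrable_loss f _).smul_measure ENNReal.ofReal_ne_top)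
    ((I.integrable_loss f _).smul_measure ENNReal.ofReal_ne_top), integral_smul_measure,
    integral_smul_measure, ENNReal.toReal_ofReal hw.1, ENNReal.toReal_ofReal (by linarith [hw.2])]
  rfl

/-- A minimizer of a weighted sum with positive weights is Pareto optimal. -/
lemma mem_paretoSet_of_minimizer {w : ℝ} (hw : w ∈ Ioo (0 : ℝ) 1) {f : I.F}
    (hf : ∀ g, I.weightedRisk w f ≤ I.weightedRisk w g) : f ∈ I.paretoSet := by
  rintro ⟨g, hg⟩
  obtain ⟨hle, k, hk⟩ := Pi.lt_def.1 hg
  have h0 := hle 0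
  have h1 := hle 1
  have := hf g
  unfold weightedRisk at this
  have hw1 : 0 < 1 - w := by linarith [hw.2]
  have hw0 := hw.1
  fin_cases k <;> simp only [Fin.zero_eta, Fin.mk_one] at hk <;> nlinarith

lemma excessRisk_eq {f₀ : I.F} (h₀ : ∀ f, I.targetRisk f₀ ≤ I.targetRisk f) (f : I.F) :
    I.excessRisk f = I.targetRisk f - I.targetRisk f₀ := by
  have : Nonempty I.F := ⟨f₀⟩
  have : ⨅ g, I.targetRisk g = I.targetRisk f₀ :=
    le_antisymm (ciInf_le ⟨_, by rintro _ ⟨f, rfl⟩; exact h₀ f⟩ f₀) (le_ciInf h₀)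
  rw [excessRisk, this]

/-- Pareto ERM has excess risk `O(1/√n)` if the target is a mixture of the sources, some optimal
hypothesis is Pareto optimal, and there is a `1/n`-Pareto set with at most three elements. -/
lemma expectedExcessRisk_paretoERM_le {n : ℕ} (hn : 0 < n) {w : ℝ} (hw : w ∈ Icc (0 : ℝ) 1)
    (hQ : I.Q = ENNReal.ofReal w • I.P 0 + ENNReal.ofReal (1 - w) • I.P 1)
    {f₀ : I.F} (hmin : ∀ f, I.targetRisk f₀ ≤ I.targetRisk f) (hpar : f₀ ∈ I.paretoSet)
    {S₀ : Finset I.F} (hS₀ : I.IsParetoCoverSet (1 / (n : ℝ)) S₀) (hcard : S₀.card ≤ 3)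
    {fhat : (Fin n → I.Z) → I.F} (hf : I.IsParetoERM (1 / (n : ℝ)) fhat) :
    I.expectedExcessRisk fhat ≤ ENNReal.ofReal (7 / √(n : ℝ)) := by
  obtain ⟨S, ⟨⟨hSsub, hScov⟩, hSmin⟩, hmeas, hERM⟩ := hf
  have hc : (S.card : ℝ) ≤ 3 := by exact_mod_cast (hSmin S₀ hS₀).trans hcard
  have hn' : (1 : ℝ) ≤ n := by exact_mod_cast hn
  have hs : 1 ≤ √(n : ℝ) := Real.one_le_sqrt.2 hn'
  obtain ⟨_, ⟨f₁, hf₁, rfl⟩, hd⟩ := hScov _ ⟨f₀, hpar, rfl⟩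
  -- Being a mixture is what matters here: an error of `1 / n` in each source risk is an error of at
  -- most `1 / n` in the target risk.
  have hR₁ : I.targetRisk f₁ ≤ I.targetRisk f₀ + 1 / n := by
    rw [I.targetRisk_of_mixture hw hQ, I.targetRisk_of_mixture hw hQ]
    obtain ⟨h0, h1⟩ := max_le_iff.1 hd
    nlinarith [hw.1, hw.2]
  -- The sum of the deviations dominates their maximum over `S`; with at most three terms this costs
  -- only a constant.
  let δ : (Fin n → I.Z) → ℝ := fun z =>
    ∑ f ∈ S, |(1 / (n : ℝ)) * ∑ i, I.loss f (z i) - ∫ x, I.loss f x ∂I.Q|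
  have hδ (f : I.F) := integral_abs_average_sub_le I.Q (I.measurable_loss f) (I.loss_mem f) hn
  have hdev (z : Fin n → I.Z) (f : I.F) (hfS : f ∈ S) :
      |I.empRisk z f - I.targetRisk f| ≤ δ z :=
    Finset.single_le_sum
      (f := fun f => |(1 / (n : ℝ)) * ∑ i, I.loss f (z i) - ∫ x, I.loss f x ∂I.Q|)
      (fun _ _ => abs_nonneg _) hfS
  have hex (z : Fin n → I.Z) : I.excessRisk (fhat z) ≤ 1 / n + 2 * δ z := by
    rw [I.excessRisk_eq hmin]
    have h1 := abs_le.1 (hdev z _ (hERM z).1)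
    have h2 := abs_le.1 (hdev z _ hf₁)
    have h3 := (hERM z).2 f₁ hf₁
    linarith [h1.1, h2.2]
  have hδint : Integrable δ (Measure.pi fun _ : Fin n => I.Q) :=
    integrable_finsetSum _ fun f _ => (hδ f).1
  have hint : Integrable (fun z => 1 / (n : ℝ) + 2 * δ z) (Measure.pi fun _ : Fin n => I.Q) :=
    (integrable_const _).add (hδint.const_mul _)
  have hδ0 (z) : 0 ≤ δ z := Finset.sum_nonneg fun _ _ => abs_nonneg _
  calc I.expectedExcessRisk fhat
      ≤ ∫⁻ z, ENNReal.ofReal (1 / n + 2 * δ z) ∂(Measure.pi fun _ : Fin n => I.Q) :=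
        lintegral_mono fun z => ENNReal.ofReal_le_ofReal (hex z)
    _ = ENNReal.ofReal (∫ z, (1 / n + 2 * δ z) ∂(Measure.pi fun _ : Fin n => I.Q)) :=
        (ofReal_integral_eq_lintegral_ofReal hint
          (ae_of_all _ fun z => by have := hδ0 z; positivity)).symm
    _ ≤ _ := by
        refine ENNReal.ofReal_le_ofReal ?_
        rw [integral_add (integrable_const _) (hδint.const_mul _), integral_const_mul,
          integral_finsetSum _ fun f _ => (hδ f).1]
        have h1 : ∑ f ∈ S, ∫ z, |(1 / (n : ℝ)) * ∑ i, I.loss f (z i) - ∫ x, I.loss f x ∂I.Q|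
            ∂(Measure.pi fun _ : Fin n => I.Q) ≤ 3 * (1 / √n) :=
          (Finset.sum_le_card_nsmul S _ _ fun f _ => (hδ f).2).trans (by
            rw [nsmul_eq_mul]; gcongr)
        have h2 : (1 : ℝ) / n ≤ 1 / √n := by
          gcongr
          nlinarith [Real.sq_sqrt (show (0 : ℝ) ≤ n by linarith)]
        simp only [integral_const, probReal_univ, smul_eq_mul, one_mul]
        calc _ ≤ 1 / √(n : ℝ) + 2 * (3 * (1 / √n)) := by gcongr
          _ = _ := by ring

end TransferInstance

/-! ### Anticoncentration of the largest of many sums of random signs -/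

/-- Among `N` products of i.i.d. factors, with factors uncorrelated for different indices, some
product exceeds half its mean with high probability. -/
lemma measure_forall_prod_le_half_mean {Z : Type*} [MeasurableSpace Z] (Q : Measure Z)
    [IsProbabilityMeasure Q] {N : ℕ} {x : Fin N → Z → ℝ} {K A B : ℝ} {n : ℕ} (hN : 0 < N)
    (hx : ∀ j, Measurable (x j)) (hbd : ∀ j z, |x j z| ≤ K) (hA : 0 < A)
    (hmean : ∀ j, ∫ z, x j z ∂Q = A) (hcor : ∀ j l, j ≠ l → ∫ z, x j z * x l z ∂Q = A ^ 2)
    (hsq : ∀ j, ∫ z, x j z * x j z ∂Q = B) (hB : 8 * B ^ n ≤ N * A ^ (2 * n)) :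
    (Measure.pi fun _ : Fin n => Q).real {z | ∀ j, ∏ i, x j (z i) ≤ A ^ n / 2} ≤ 1 / 2 := by
  set π := Measure.pi fun _ : Fin n => Q with hπ
  have hN' : (0 : ℝ) < N := by exact_mod_cast hN
  let X : Fin N → (Fin n → Z) → ℝ := fun j z => ∏ i, x j (z i)
  have hXm (j) : Measurable (X j) := by fun_prop
  have hXb (j z) : ‖X j z‖ ≤ K ^ n := by
    rw [Real.norm_eq_abs, Finset.abs_prod]
    simpa using Finset.prod_le_prod (s := Finset.univ) (fun i _ => abs_nonneg (x j (z i)))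
      fun i _ => hbd j (z i)
  have hXL (j) : MemLp (X j) 2 π := MemLp.of_bound (hXm j).aestronglyMeasurable _
    (ae_of_all _ (hXb j))
  have hXi (j) : Integrable (X j) π := (hXL j).integrable (by norm_num)
  have hXX (j l) : Integrable (fun z => X j z * X l z) π := (hXL j).integrable_mul (hXL l)
  have hE (j) : ∫ z, X j z ∂π = A ^ n := by
    have := integral_fintype_prod_eq_prod (μ := fun _ : Fin n => Q) (fun _ => x j)
    simpa [hmean] using this
  have hEE (j l) : ∫ z, X j z * X l z ∂π = (∫ z, x j z * x l z ∂Q) ^ n := by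
    have := integral_fintype_prod_eq_prod (μ := fun _ : Fin n => Q) (fun _ z => x j z * x l z)
    simpa [Finset.prod_mul_distrib] using this
  let V : (Fin n → Z) → ℝ := fun z => (∑ j, (X j z - A ^ n)) ^ 2
  have hVe : V = fun z => ∑ j, ∑ l, (X j z * X l z - A ^ n * X j z - A ^ n * X l z + A ^ n * A ^ n) := by
    funext z
    simp only [V, sq, Finset.sum_mul_sum]
    refine Finset.sum_congr rfl fun j _ => Finset.sum_congr rfl fun l _ => by ring
  have hc (j) : Integrable (fun z => A ^ n * X j z) π := (hXi j).const_mul _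
  have hd (j l) : Integrable (fun z => X j z * X l z - A ^ n * X j z) π := (hXX j l).sub (hc j)
  have hd' (j l) : Integrable (fun z => X j z * X l z - A ^ n * X j z - A ^ n * X l z) π :=
    (hd j l).sub (hc l)
  have hterm (j l) : Integrable
      (fun z => X j z * X l z - A ^ n * X j z - A ^ n * X l z + A ^ n * A ^ n) π :=
    (hd' j l).add (integrable_const _)
  have hVi : Integrable V π := by
    rw [hVe]
    exact integrable_finsetSum _ fun j _ => integrable_finsetSum _ fun l _ => hterm j l
  have hVint : ∫ z, V z ∂π ≤ N * B ^ n := by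
    -- Off the diagonal the covariance vanishes, so only `N` terms survive, each at most `B ^ n`.
    have hval (j l) : ∫ z, (X j z * X l z - A ^ n * X j z - A ^ n * X l z + A ^ n * A ^ n) ∂π
        ≤ if j = l then B ^ n else 0 := by
      rw [integral_add (hd' j l) (integrable_const _), integral_sub (hd j l) (hc l),
        integral_sub (hXX j l) (hc j), integral_const_mul, integral_const_mul, hE, hE, hEE]
      simp only [integral_const, probReal_univ, smul_eq_mul, one_mul]
      split_ifs with h
      · subst h
        rw [hsq]
        nlinarith [mul_self_nonneg (A ^ n)]
      · rw [hcor j l h, ← pow_mul, mul_comm 2 n, pow_mul]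
        nlinarith
    rw [hVe, integral_finsetSum _ fun j _ => integrable_finsetSum _ fun l _ => hterm j l]
    calc _ ≤ ∑ j : Fin N, B ^ n := Finset.sum_le_sum fun j _ => by
          rw [integral_finsetSum _ fun l _ => hterm j l]
          refine (Finset.sum_le_sum fun l _ => hval j l).trans ?_
          simp
      _ = N * B ^ n := by simp
  -- If every product is at most half its mean, the centred sum is at most `-N A ^ n / 2`;
  -- Chebyshev's inequality makes this unlikely.
  have hsub : {z | ∀ j, ∏ i, x j (z i) ≤ A ^ n / 2} ⊆ {z | (N * A ^ n / 2) ^ 2 ≤ V z} := by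
    intro z hz
    have h1 : ∑ j, (X j z - A ^ n) ≤ ∑ j : Fin N, (-(A ^ n / 2)) :=
      Finset.sum_le_sum fun j _ => by have := hz j; simp only [X]; linarith
    simp only [Finset.sum_const, Finset.card_univ, Fintype.card_fin, nsmul_eq_mul] at h1
    have hp : 0 < (N : ℝ) * A ^ n := by positivity
    simp only [V, mem_ofPred_eq]
    nlinarith
  have hmk := mul_meas_ge_le_integral_of_nonneg (μ := π) (f := V)
    (ae_of_all _ fun z => sq_nonneg _) hVi ((N * A ^ n / 2) ^ 2)
  have hle := measureReal_mono (μ := π) hsub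
  have hp : 0 < (N * A ^ n / 2) ^ 2 := by positivity
  refine hle.trans ?_
  rw [← mul_le_mul_iff_right₀ hp]
  refine (hmk.trans hVint).trans ?_
  calc (N : ℝ) * B ^ n = N / 8 * (8 * B ^ n) := by ring
    _ ≤ N / 8 * (N * A ^ (2 * n)) := by gcongr
    _ = _ := by rw [mul_comm 2 n, pow_mul]; ring

/-- The law of a fair coin. -/
def fairCoin : Measure Bool :=
  (2⁻¹ : ENNReal) • Measure.dirac true + (2⁻¹ : ENNReal) • Measure.dirac false

instance : IsProbabilityMeasure fairCoin :=
  ⟨by simp [fairCoin, ENNReal.inv_two_add_inv_two]⟩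

lemma integral_fairCoin (g : Bool → ℝ) : ∫ b, g b ∂fairCoin = (g true + g false) / 2 := by
  unfold fairCoin
  rw [integral_add_measure (Integrable.of_finite.smul_measure (by simp))
    (Integrable.of_finite.smul_measure (by simp)), integral_smul_measure, integral_smul_measure,
    integral_dirac, integral_dirac, ENNReal.toReal_inv, ENNReal.toReal_ofNat, smul_eq_mul,
    smul_eq_mul]
  ring

/-- The law of `N` independent fair coins. -/
abbrev coins (N : ℕ) : Measure (Fin N → Bool) := Measure.pi fun _ => fairCoin

lemma integral_coins_eval {N : ℕ} (j : Fin N) (g : Bool → ℝ) :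
    ∫ y, g (y j) ∂(coins N) = (g true + g false) / 2 := by
  have hp := measurePreserving_eval (fun _ : Fin N => fairCoin) j
  rw [← integral_fairCoin, ← hp.map_eq, integral_map hp.measurable.aemeasurable
    (Measurable.of_discrete.aestronglyMeasurable)]

lemma integral_coins_eval_mul {N : ℕ} {j l : Fin N} (h : j ≠ l) (g : Bool → ℝ) :
    ∫ y, g (y j) * g (y l) ∂(coins N) = ((g true + g false) / 2) ^ 2 := by
  have h1 := integral_fintype_prod_eq_prod (μ := fun _ : Fin N => fairCoin)
    (fun i b => if i = j ∨ i = l then g b else 1)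
  have h2 (y : Fin N → Bool) : ∏ i, (if i = j ∨ i = l then g (y i) else 1) = g (y j) * g (y l) := by
    rw [← Finset.prod_filter, ← Finset.prod_pair h (f := fun i => g (y i))]
    congr 1; ext i; simp
  simp_rw [h2] at h1
  rw [h1, ← Finset.prod_subset (Finset.subset_univ {j, l}), Finset.prod_pair h]
  · simp [integral_fairCoin, sq]
  · intro i _ hi
    simp only [Finset.mem_insert, Finset.mem_singleton] at hi
    simp only [hi, if_false, integral_const, probReal_univ, smul_eq_mul, mul_one]

/-- The sign of a coin. -/
def coinSign (b : Bool) : ℝ := if b then 1 else -1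

lemma abs_coinSign (b : Bool) : |coinSign b| = 1 := by cases b <;> simp [coinSign]

/-- Both sides are compared with `1 + t ^ 2 / 2`: `cosh t = 1 + 2 sinh (t / 2) ^ 2` lies above it,
and `exp x ≤ 1 + 2 x` on `[0, 1]` puts the exponential below it. -/
lemma exp_sq_div_four_le_cosh {t : ℝ} (ht : |t| ≤ 1) : Real.exp (t ^ 2 / 4) ≤ Real.cosh t := by
  have ht2 : t ^ 2 ≤ 1 := by rw [← sq_abs]; exact pow_le_one₀ (abs_nonneg _) ht
  have h1 : 1 + t ^ 2 / 2 ≤ Real.cosh t := by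
    have hc : Real.cosh t = 1 + 2 * Real.sinh (t / 2) ^ 2 := by
      have := Real.cosh_two_mul (t / 2)
      rw [mul_div_cancel₀ t two_ne_zero, Real.cosh_sq] at this
      linarith
    have hs : |t / 2| ≤ |Real.sinh (t / 2)| := by
      rw [Real.abs_sinh]; exact Real.self_le_sinh_iff.2 (abs_nonneg _)
    have := sq_le_sq.2 hs
    rw [hc]; nlinarith
  have h2 := Real.exp_bound' (x := t ^ 2 / 4) (by positivity) (by linarith) (n := 1) one_pos
  norm_num at h2
  nlinarith [sq_nonneg t]

/-- Lower bound for the largest of `N` independent sums of `n` random signs. -/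
lemma measure_forall_sum_coinSign_lt {Z : Type*} [MeasurableSpace Z] (Q : Measure Z)
    [IsProbabilityMeasure Q] {N n : ℕ} (y : Z → Fin N → Bool) (hy : Measurable y)
    (hlaw : ∀ g : (Fin N → Bool) → ℝ, ∫ z, g (y z) ∂Q = ∫ b, g b ∂(coins N))
    (hN : 0 < N) {t : ℝ} (ht : 0 < t) (ht1 : t ≤ 1) (hnt : 8 * Real.log 2 ≤ n * t ^ 2)
    (hB : 8 * Real.exp (2 * (n * t ^ 2)) ≤ N) :
    (Measure.pi fun _ : Fin n => Q).real
      {z | ∀ j, ∑ i, coinSign (y (z i) j) ≤ n * t / 8} ≤ 1 / 2 := by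
  have hexp (b : Bool) (s : ℝ) : Real.exp (s * coinSign b) ≤ Real.exp |s| := by
    refine Real.exp_le_exp.2 ((le_abs_self _).trans ?_)
    rw [abs_mul, abs_coinSign, mul_one]
  have hav (s : ℝ) : (Real.exp (s * coinSign true) + Real.exp (s * coinSign false)) / 2
      = Real.cosh s := by
    simp [coinSign, Real.cosh_eq]
  -- The products are the exponentials of `t` times the sums, so that a product above half its mean
  -- forces a large sum.
  have hmain := measure_forall_prod_le_half_mean Q (n := n) (x := fun j z => Real.exp (t * coinSign (y z j)))
    (K := Real.exp |t|) (A := Real.cosh t) (B := Real.cosh (2 * t)) hN ?_ ?_ (Real.cosh_pos t) ?_ ?_ ?_ ?_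
  · refine (measureReal_mono (μ := Measure.pi fun _ : Fin n => Q) ?_).trans hmain
    intro z hz j
    rw [← Real.exp_sum, ← Finset.mul_sum]
    have h1 : Real.exp (n * t ^ 2 / 4) ≤ Real.cosh t ^ n := by
      have := pow_le_pow_left₀ (Real.exp_pos _).le
        (exp_sq_div_four_le_cosh (t := t) (by rwa [abs_of_pos ht])) n
      rwa [← Real.exp_nat_mul, ← mul_div_assoc] at this
    -- The assumption `8 log 2 ≤ n t ^ 2` absorbs the factor `1 / 2`, leaving `n t ^ 2 / 8` of the
    -- exponent `n t ^ 2 / 4`.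
    have h2 : t * ∑ i, coinSign (y (z i) j) ≤ n * t ^ 2 / 4 - Real.log 2 := by
      have := mul_le_mul_of_nonneg_left (hz j) ht.le
      nlinarith
    calc _ ≤ Real.exp (n * t ^ 2 / 4 - Real.log 2) := Real.exp_le_exp.2 h2
      _ = Real.exp (n * t ^ 2 / 4) / 2 := by rw [Real.exp_sub, Real.exp_log two_pos]
      _ ≤ _ := by gcongr
  · intro j
    exact (Measurable.of_discrete (f := fun b : Fin N → Bool => Real.exp (t * coinSign (b j)))).comp hy
  · intro j z
    rw [abs_of_pos (Real.exp_pos _)]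
    exact hexp _ _
  · intro j
    rw [hlaw fun b => Real.exp (t * coinSign (b j)),
      integral_coins_eval j fun b => Real.exp (t * coinSign b), hav]
  · intro j l h
    rw [hlaw fun b => Real.exp (t * coinSign (b j)) * Real.exp (t * coinSign (b l)),
      integral_coins_eval_mul h fun b => Real.exp (t * coinSign b), hav]
  · intro j
    rw [hlaw fun b => Real.exp (t * coinSign (b j)) * Real.exp (t * coinSign (b j))]
    simp_rw [← Real.exp_add, ← two_mul, ← mul_assoc]
    rw [integral_coins_eval j fun b => Real.exp (2 * t * coinSign b), hav]
  · have h1 : Real.cosh (2 * t) ^ n ≤ Real.exp (2 * (n * t ^ 2)) := by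
      have := pow_le_pow_left₀ (Real.cosh_pos _).le (Real.cosh_le_exp_half_sq (2 * t)) n
      rwa [← Real.exp_nat_mul, show n * ((2 * t) ^ 2 / 2) = 2 * (n * t ^ 2) by ring] at this
    have h2 : 1 ≤ Real.cosh t ^ (2 * n) := one_le_pow₀ (Real.one_le_cosh t)
    calc 8 * Real.cosh (2 * t) ^ n ≤ N := by linarith
      _ ≤ N * Real.cosh t ^ (2 * n) := le_mul_of_one_le_right (by positivity) h2

/-! ### Instances with prescribed source risks and centred noise -/

/-- The hypotheses have source risks `R f k`, perturbed by centred noise `ξ f` that depends on a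
part of the observation whose law is the same for both sources; the other part tells the source. -/
abbrev noisyInstance {F Y : Type} [Finite F] [Nonempty F] [MeasurableSpace Y] (μ : Measure Y)
    [IsProbabilityMeasure μ] (R : F → Fin 2 → ℝ) (ξ : F → Y → ℝ) {w : ℝ} (hw : w ∈ Icc (0 : ℝ) 1)
    (hR : ∀ f k, R f k ∈ Icc (1 / 4 : ℝ) (3 / 4)) (hm : ∀ f, Measurable (ξ f))
    (hξ : ∀ f y, |ξ f y| ≤ 1 / 4) : TransferInstance where
  F := F
  Z := Fin 2 × Y
  mZ := inferInstance
  loss f z := R f z.1 + ξ f z.2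
  measurable_loss f := ((Measurable.of_discrete (f := R f)).comp measurable_fst).add
    ((hm f).comp measurable_snd)
  loss_mem f z := by
    have h1 := hR f z.1
    have h2 := abs_le.1 (hξ f z.2)
    constructor <;> linarith [h1.1, h1.2, h2.1, h2.2]
  P k := (Measure.dirac k).prod μ
  Q := ENNReal.ofReal w • (Measure.dirac 0).prod μ + ENNReal.ofReal (1 - w) • (Measure.dirac 1).prod μ
  isProbabilityMeasure_P _ := inferInstance
  isProbabilityMeasure_Q := ⟨by
    simp only [Measure.coe_add, Measure.coe_smul, Pi.add_apply, Pi.smul_apply, measure_univ,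
      smul_eq_mul, mul_one]
    rw [← ENNReal.ofReal_add hw.1 (by linarith [hw.2])]; simp⟩
  isCompact_risks := (finite_range _).isCompact
  exists_target_minimizer := Finite.exists_min _

section noisyInstance

variable {F Y : Type} [Finite F] [Nonempty F] [MeasurableSpace Y] (μ : Measure Y)
    [IsProbabilityMeasure μ] (R : F → Fin 2 → ℝ) (ξ : F → Y → ℝ) {w : ℝ} (hw : w ∈ Icc (0 : ℝ) 1)
    (hR : ∀ f k, R f k ∈ Icc (1 / 4 : ℝ) (3 / 4)) (hm : ∀ f, Measurable (ξ f))
    (hξ : ∀ f y, |ξ f y| ≤ 1 / 4)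

lemma noisyInstance_sourceRisk (h0 : ∀ f, ∫ y, ξ f y ∂μ = 0) (f : F) (k : Fin 2) :
    (noisyInstance μ R ξ hw hR hm hξ).sourceRisk f k = R f k := by
  have hint : Integrable (ξ f) μ := Integrable.of_bound (hm f).aestronglyMeasurable _
    (ae_of_all _ (hξ f))
  change ∫ z : Fin 2 × Y, (R f z.1 + ξ f z.2) ∂((Measure.dirac k).prod μ) = _
  have hmeas : Measurable fun z : Fin 2 × Y => R f z.1 + ξ f z.2 :=
    (noisyInstance μ R ξ hw hR hm hξ).measurable_loss f
  rw [Measure.dirac_prod, integral_map measurable_prodMk_left.aemeasurable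
    hmeas.aestronglyMeasurable]
  simp only
  rw [integral_add (integrable_const _) hint, h0]
  simp

end noisyInstance

/-! ### Properties shared by all three instances -/

namespace TransferInstance
variable (I : TransferInstance)

/-- The target is a mixture of the sources, every hypothesis minimizes a weighted sum of the source
risks with positive weights, and three hypotheses suffice for a cover at scale `t`. -/
def IsEasy (t : ℝ) : Prop :=
  (∃ w ∈ Icc (0 : ℝ) 1, I.Q = ENNReal.ofReal w • I.P 0 + ENNReal.ofReal (1 - w) • I.P 1) ∧
  (∀ f, ∃ w ∈ Ioo (0 : ℝ) 1, ∀ g, I.weightedRisk w f ≤ I.weightedRisk w g) ∧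
  ∃ S : Finset I.F, S.card ≤ 3 ∧ ∀ f, ∃ g ∈ S, ∀ k, I.sourceRisk g k ≤ I.sourceRisk f k + t

variable {I}

lemma le_expectedExcessRisk {n : ℕ} {c : ℝ} {fhat : (Fin n → I.Z) → I.F}
    (h : ∀ z, c ≤ I.excessRisk (fhat z)) : ENNReal.ofReal c ≤ I.expectedExcessRisk fhat := by
  calc ENNReal.ofReal c = ∫⁻ _, ENNReal.ofReal c ∂(Measure.pi fun _ : Fin n => I.Q) := by simp
    _ ≤ _ := lintegral_mono fun z => ENNReal.ofReal_le_ofReal (h z)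

lemma IsEasy.isSupported {t : ℝ} (h : I.IsEasy t) {r : Fin 2 → ℝ} (hr : r ∈ I.paretoFront) :
    I.IsSupported r := by
  obtain ⟨f, -, rfl⟩ := hr
  obtain ⟨w, hw, hf⟩ := h.2.1 f
  exact ⟨w, ⟨hw.1.le, hw.2.le⟩, hf⟩

lemma IsEasy.expectedExcessRisk_le {n : ℕ} (hn : 0 < n) (h : I.IsEasy (1 / (n : ℝ)))
    {fhat : (Fin n → I.Z) → I.F} (hf : I.IsParetoERM (1 / (n : ℝ)) fhat) :
    I.expectedExcessRisk fhat ≤ ENNReal.ofReal (7 / √(n : ℝ)) := by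
  obtain ⟨⟨w, hw, hQ⟩, hpar, S, hS, hcov⟩ := h
  have hpar' (f : I.F) : f ∈ I.paretoSet := by
    obtain ⟨v, hv, hf⟩ := hpar f
    exact I.mem_paretoSet_of_minimizer hv hf
  obtain ⟨f₀, hf₀⟩ := I.exists_target_minimizer
  refine I.expectedExcessRisk_paretoERM_le hn hw hQ hf₀ (hpar' f₀) (S₀ := S) ⟨?_, ?_⟩ hS hf
  · exact image_mono fun f _ => hpar' f
  · rintro _ ⟨f, -, rfl⟩
    obtain ⟨g, hg, hgf⟩ := hcov f
    exact ⟨_, ⟨g, hg, rfl⟩, max_le (by linarith [hgf 0]) (by linarith [hgf 1])⟩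

end TransferInstance

/-! ### Instances against coarse grids -/

/-- Source risks of three hypotheses; hypothesis `0` minimizes the weighted sums exactly for the
weights in `[v - s, v + s]`. -/
def kinkRisk (v s : ℝ) : Fin 3 → Fin 2 → ℝ :=
  ![![1 / 2, 1 / 2], ![1 / 2 + (1 - (v - s)) / 4, 1 / 2 - (v - s) / 4],
    ![1 / 2 - (1 - (v + s)) / 4, 1 / 2 + (v + s) / 4]]

lemma kinkRisk_mem {v s : ℝ} (hs : 0 < s) (h0 : s < v) (h1 : v + s < 1) (f : Fin 3) (k : Fin 2) :
    kinkRisk v s f k ∈ Icc (1 / 4 : ℝ) (3 / 4) := by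
  fin_cases f <;> fin_cases k <;> simp [kinkRisk] <;> constructor <;> linarith

/-- The three hypotheses with risks `kinkRisk v s`, and the target with weight `v`. -/
abbrev kinkInstance {v s : ℝ} (hs : 0 < s) (h0 : s < v) (h1 : v + s < 1) : TransferInstance :=
  noisyInstance (Measure.dirac ()) (kinkRisk v s) (fun _ _ => 0) (w := v)
    ⟨by linarith, by linarith⟩ (kinkRisk_mem hs h0 h1) (fun _ => measurable_const) (by norm_num)

section kinkInstance
variable {v s : ℝ} (hs : 0 < s) (h0 : s < v) (h1 : v + s < 1)

lemma kinkInstance_sourceRisk (f : Fin 3) (k : Fin 2) :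
    (kinkInstance hs h0 h1).sourceRisk f k = kinkRisk v s f k :=
  noisyInstance_sourceRisk _ _ _ _ _ _ _ (by simp) f k

lemma kinkInstance_weightedRisk (w : ℝ) (f : Fin 3) :
    (kinkInstance hs h0 h1).weightedRisk w f
      = 1 / 2 + ![0, (w - (v - s)) / 4, (v + s - w) / 4] f := by
  unfold TransferInstance.weightedRisk
  rw [kinkInstance_sourceRisk, kinkInstance_sourceRisk]
  fin_cases f <;> simp [kinkRisk] <;> ring

lemma kinkInstance_isEasy {t : ℝ} (ht : 0 ≤ t) : (kinkInstance hs h0 h1).IsEasy t := by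
  refine ⟨⟨v, ⟨by linarith, by linarith⟩, rfl⟩, ?_, (Finset.univ : Finset (Fin 3)), by simp,
    fun f => ⟨f, Finset.mem_univ (α := Fin 3) f, fun k => by linarith⟩⟩
  intro (f : Fin 3)
  -- The other two hypotheses tie with hypothesis `0` at the ends of its interval, and each is a
  -- minimizer there.
  refine ⟨![v, v - s, v + s] f, ?_, fun (g : Fin 3) => ?_⟩
  · fin_cases f <;> simp <;> constructor <;> linarith
  · rw [kinkInstance_weightedRisk, kinkInstance_weightedRisk]
    fin_cases f <;> fin_cases g <;> simp <;> linarith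

/-- Off the interval, hypothesis `0` is strictly beaten by one of the others, so no tie-breaking
rule selects it. Every candidate left has excess risk `s / 4`, whatever the sample. -/
lemma kinkInstance_expectedExcessRisk_ge {n : ℕ} {Λ : Set ℝ}
    (hΛ : ∀ w ∈ Λ, w ∉ Icc (v - s) (v + s))
    {fhat : (Fin n → (kinkInstance hs h0 h1).Z) → (kinkInstance hs h0 h1).F}
    (hf : (kinkInstance hs h0 h1).IsLMSA Λ fhat) :
    ENNReal.ofReal (s / 4) ≤ (kinkInstance hs h0 h1).expectedExcessRisk fhat := by
  obtain ⟨sel, hsel, -, hERM⟩ := hf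
  have htarget (f : Fin 3) : (kinkInstance hs h0 h1).targetRisk f
      = 1 / 2 + ![0, s / 4, s / 4] f := by
    rw [TransferInstance.targetRisk_of_mixture _ (w := v) ⟨by linarith, by linarith⟩ rfl]
    refine (kinkInstance_weightedRisk hs h0 h1 v f).trans ?_
    fin_cases f <;> simp
  have hmin : ∀ f, (kinkInstance hs h0 h1).targetRisk (0 : Fin 3)
      ≤ (kinkInstance hs h0 h1).targetRisk f := by
    intro (f : Fin 3)
    rw [htarget, htarget]
    fin_cases f <;> simp <;> linarith
  have hge (z) : s / 4 ≤ (kinkInstance hs h0 h1).excessRisk (fhat z) := by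
    obtain ⟨w, hw, hwz⟩ := (hERM z).1
    rw [TransferInstance.excessRisk_eq _ hmin, ← hwz, htarget, htarget]
    have h2 := hsel w hw (1 : Fin 3)
    have h3 := hsel w hw (2 : Fin 3)
    rw [kinkInstance_weightedRisk, kinkInstance_weightedRisk] at h2 h3
    have hw' := hΛ w hw
    generalize sel w = f at h2 h3
    change Fin 3 at f
    fin_cases f
    · refine absurd ⟨?_, ?_⟩ hw' <;> simp at h2 h3 <;> linarith
    · simp
    · simp
  exact TransferInstance.le_expectedExcessRisk hge

end kinkInstance

/-! ### Fine and coarse grids -/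

/-- A grid of width `h < t` has a point within `t / 2` of every point at distance at least `t / 2`
from the ends of the unit interval. -/
lemma exists_mem_grid {h θ t u : ℝ} (hh : 0 < h) (hht : h < t) (h0 : t / 2 ≤ u)
    (h1 : u + t / 2 ≤ 1) :
    ∃ x ∈ {x | ∃ m : ℤ, x = θ + h * m} ∩ Icc (0 : ℝ) 1, |u - x| < t / 2 := by
  have hr := abs_sub_round ((u - θ) / h)
  set m := round ((u - θ) / h)
  have hx : |u - (θ + h * m)| < t / 2 := by
    have : u - (θ + h * m) = h * ((u - θ) / h - m) := by field_simp; ring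
    rw [this, abs_mul, abs_of_pos hh]
    nlinarith
  have := abs_lt.1 hx
  exact ⟨_, ⟨⟨m, rfl⟩, by linarith, by linarith⟩, hx⟩

/-- Of two intervals closer to each other than the width of the grid, one has no grid point. -/
lemma grid_gap {h θ v s d : ℝ} (hh : 0 < h) (hsd : 2 * s < d) (hd : d + 2 * s < h) :
    (∀ x ∈ {x | ∃ m : ℤ, x = θ + h * m} ∩ Icc (0 : ℝ) 1, x ∉ Icc (v - s) (v + s)) ∨
    (∀ x ∈ {x | ∃ m : ℤ, x = θ + h * m} ∩ Icc (0 : ℝ) 1, x ∉ Icc (v + d - s) (v + d + s)) := by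
  by_contra! H
  obtain ⟨⟨_, ⟨⟨m, rfl⟩, -⟩, hx⟩, _, ⟨⟨l, rfl⟩, -⟩, hy⟩ := H
  have h1 : 0 < h * ((l - m : ℤ) : ℝ) := by push_cast; linarith [hx.2, hy.1]
  have h2 : h * ((l - m : ℤ) : ℝ) < h * 1 := by push_cast; linarith [hx.1, hy.2]
  have h3 := (mul_pos_iff_of_pos_left hh).1 h1
  have h4 := (mul_lt_mul_iff_right₀ hh).1 h2
  norm_cast at h3 h4
  omega

lemma sum_lt_sum_of_shift {n : ℕ} {t : ℝ} (a b d : Fin n → ℝ)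
    (h : ∀ i, a i ≤ b i + (t / 32 - d i / 4)) (hd : n * t / 8 < ∑ i, d i) :
    ∑ i, a i < ∑ i, b i := by
  have := Finset.sum_le_sum (s := Finset.univ) fun i _ => h i
  rw [Finset.sum_add_distrib, Finset.sum_sub_distrib,
    ← Finset.sum_div _ d] at this
  simp only [Finset.sum_const, Finset.card_univ, Fintype.card_fin, nsmul_eq_mul] at this
  linarith

/-! ### Instance against fine grids -/

/-- A hypothesis `none`, optimal for weights near `1`, and a cluster of hypotheses `some j` with
nearly the same source risks; the weighted sum with weight `w` is minimized on the cluster by the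
`j` with `1 / 4 + j * t` nearest to `w`. -/
def clusterRisk (N : ℕ) (t ε : ℝ) : Option (Fin N) → Fin 2 → ℝ
  | none => ![1 / 4, 3 / 4]
  | some j => ![1 / 4 + t / 64 + ε * (1 - (1 / 4 + j * t)) ^ 2, 1 / 4 + ε * (1 / 4 + j * t) ^ 2]

/-- The loss of the cluster is perturbed by independent random signs. -/
def clusterNoise (N : ℕ) : Option (Fin N) → (Fin N → Bool) → ℝ
  | none, _ => 0
  | some j, y => -(coinSign (y j) / 4)

lemma cluster_node_mem {N : ℕ} {t : ℝ} (ht : 0 < t) (hNt : N * t ≤ 1 / 4) (j : Fin N) : 1 / 4 + (j : ℝ) * t ∈ Icc (1 / 4 : ℝ) (1 / 2) := by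
  have : (j : ℝ) ≤ N := by exact_mod_cast j.2.le
  constructor <;> nlinarith [mul_nonneg (Nat.cast_nonneg (α := ℝ) j) ht.le]

lemma clusterRisk_mem {N : ℕ} {t ε : ℝ} (ht : 0 < t) (hNt : N * t ≤ 1 / 4) (hε : 0 < ε)
    (hεt : ε ≤ t / 64) (ht1 : t ≤ 1 / 4) (f : Option (Fin N)) (k : Fin 2) :
    clusterRisk N t ε f k ∈ Icc (1 / 4 : ℝ) (3 / 4) := by
  rcases f with _ | j
  · fin_cases k <;> simp [clusterRisk] <;> norm_num
  · have := cluster_node_mem ht hNt j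
    set u := 1 / 4 + (j : ℝ) * t with hu
    have h1 : (1 - u) ^ 2 ≤ 1 := by nlinarith [this.1, this.2]
    have h2 : u ^ 2 ≤ 1 := by nlinarith [this.1, this.2]
    have h3 : ε * (1 - u) ^ 2 ≤ ε * 1 := by gcongr
    have h4 : ε * u ^ 2 ≤ ε * 1 := by gcongr
    have h5 : 0 ≤ ε * (1 - u) ^ 2 := by positivity
    have h6 : 0 ≤ ε * u ^ 2 := by positivity
    fin_cases k <;> simp only [clusterRisk, Fin.zero_eta, Fin.mk_one, Matrix.cons_val_zero,
      Matrix.cons_val_one, ← hu] <;> constructor <;> linarith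

lemma abs_clusterNoise_le {N : ℕ} (f : Option (Fin N)) (y : Fin N → Bool) : |clusterNoise N f y| ≤ 1 / 4 := by
  rcases f with _ | j
  · simp [clusterNoise]
  · simp [clusterNoise, abs_div, abs_coinSign]

section clusterInstance
variable {N : ℕ} {t ε : ℝ} (ht : 0 < t) (hNt : N * t ≤ 1 / 4) (hε : 0 < ε) (hεt : ε ≤ t / 64)
  (ht1 : t ≤ 1 / 4)

/-- The hypotheses with risks `clusterRisk N t ε`; the target is the first source. -/
abbrev clusterInstance : TransferInstance :=
  noisyInstance (coins N) (clusterRisk N t ε) (clusterNoise N) (w := 1) ⟨zero_le_one, le_rfl⟩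
    (clusterRisk_mem ht hNt hε hεt ht1) (fun _ => Measurable.of_discrete) abs_clusterNoise_le

lemma clusterInstance_sourceRisk (f : Option (Fin N)) (k : Fin 2) :
    (clusterInstance ht hNt hε hεt ht1).sourceRisk f k = clusterRisk N t ε f k := by
  refine noisyInstance_sourceRisk _ _ _ _ _ _ _ (fun f => ?_) f k
  rcases f with _ | j
  · simp [clusterNoise]
  · simp only [clusterNoise]
    rw [integral_coins_eval j fun b => -(coinSign b / 4)]
    norm_num [coinSign]

lemma clusterInstance_weightedRisk_none (w : ℝ) :
    (clusterInstance ht hNt hε hεt ht1).weightedRisk w (none : Option (Fin N))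
      = 1 / 4 + (1 - w) / 2 := by
  unfold TransferInstance.weightedRisk
  rw [clusterInstance_sourceRisk, clusterInstance_sourceRisk]
  simp [clusterRisk]; ring

/-- Completing the square in `w (1 - u) ^ 2 + (1 - w) u ^ 2` at the node `u = 1 / 4 + j t` shows
that the node nearest to `w` wins. -/
lemma clusterInstance_weightedRisk_some (w : ℝ) (j : Fin N) :
    (clusterInstance ht hNt hε hεt ht1).weightedRisk w (some j : Option (Fin N))
      = 1 / 4 + w * (t / 64) + ε * ((1 / 4 + j * t - w) ^ 2 + w * (1 - w)) := by
  unfold TransferInstance.weightedRisk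
  rw [clusterInstance_sourceRisk, clusterInstance_sourceRisk]
  simp [clusterRisk]; ring

/-- For weights up to `3 / 4`, the cluster beats the other hypothesis. -/
lemma clusterInstance_weightedRisk_some_lt {w : ℝ} (h0 : 0 ≤ w) (h1 : w ≤ 3 / 4) (j : Fin N) :
    (clusterInstance ht hNt hε hεt ht1).weightedRisk w (some j : Option (Fin N))
      < (clusterInstance ht hNt hε hεt ht1).weightedRisk w (none : Option (Fin N)) := by
  rw [clusterInstance_weightedRisk_some, clusterInstance_weightedRisk_none]
  have := cluster_node_mem ht hNt j
  set u := 1 / 4 + (j : ℝ) * t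
  have h2 : (u - w) ^ 2 + w * (1 - w) ≤ 2 := by nlinarith [this.1, this.2]
  have h3 : ε * ((u - w) ^ 2 + w * (1 - w)) ≤ ε * 2 := by gcongr
  nlinarith

lemma clusterInstance_isEasy (hN : 0 < N) : (clusterInstance ht hNt hε hεt ht1).IsEasy ε := by
  refine ⟨⟨1, ⟨zero_le_one, le_rfl⟩, rfl⟩, ?_, ({none, some ⟨0, hN⟩} : Finset (Option (Fin N))),
    Finset.card_le_two.trans (by norm_num), ?_⟩
  · rintro (_ | j)
    -- The target weight `1` is not allowed, as the weights have to be positive. At `1 - t / 64` the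
    -- second source costs `none` only `t / 128`, below the head start `t / 64` in the first.
    · refine ⟨1 - t / 64, ⟨by linarith, by linarith⟩, ?_⟩
      rintro (_ | l)
      · rfl
      · erw [clusterInstance_weightedRisk_some, clusterInstance_weightedRisk_none]
        have : 0 ≤ ε * ((1 / 4 + l * t - (1 - t / 64)) ^ 2 + (1 - t / 64) * (1 - (1 - t / 64))) :=
          mul_nonneg hε.le (add_nonneg (sq_nonneg _) (mul_nonneg (by linarith) (by linarith)))
        nlinarith
    · have hj := cluster_node_mem ht hNt j
      refine ⟨1 / 4 + j * t, ⟨by linarith [hj.1], by linarith [hj.2]⟩, ?_⟩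
      rintro (_ | l)
      · exact (clusterInstance_weightedRisk_some_lt ht hNt hε hεt ht1 (by linarith [hj.1])
          (by linarith [hj.2]) j).le
      · erw [clusterInstance_weightedRisk_some, clusterInstance_weightedRisk_some]
        refine add_le_add le_rfl (mul_le_mul_of_nonneg_left (add_le_add ?_ le_rfl) hε.le)
        rw [sub_self, zero_pow two_ne_zero]
        exact sq_nonneg _
  · rintro (_ | j)
    · exact ⟨(none : Option (Fin N)), by simp, fun k => by linarith⟩
    -- Within the cluster the source risks differ by at most `ε`, so any one member covers the rest.
    · refine ⟨(some ⟨0, hN⟩ : Option (Fin N)), by simp, fun k => ?_⟩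
      erw [clusterInstance_sourceRisk, clusterInstance_sourceRisk]
      have hj := cluster_node_mem ht hNt j
      set u := 1 / 4 + (j : ℝ) * t with hu
      have h3 : 0 ≤ ε * (1 - u) ^ 2 := by positivity
      have h4 : 0 ≤ ε * u ^ 2 := by positivity
      fin_cases k <;> simp only [clusterRisk, Fin.zero_eta, Fin.mk_one, Matrix.cons_val_zero,
        Matrix.cons_val_one, ← hu] <;> norm_num <;> linarith

/-- The hypotheses that LMSA selects with a fine grid contain the whole cluster. -/
lemma clusterInstance_selects_cluster {h θ : ℝ} (hh : 0 < h) (hht : h < t)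
    {sel : ℝ → (clusterInstance ht hNt hε hεt ht1).F}
    (hsel : ∀ w ∈ {x | ∃ m : ℤ, x = θ + h * m} ∩ Icc (0 : ℝ) 1, ∀ f,
      (clusterInstance ht hNt hε hεt ht1).weightedRisk w (sel w)
        ≤ (clusterInstance ht hNt hε hεt ht1).weightedRisk w f) (j : Fin N) :
    (some j : Option (Fin N)) ∈ sel '' ({x | ∃ m : ℤ, x = θ + h * m} ∩ Icc (0 : ℝ) 1) := by
  have hj := cluster_node_mem ht hNt j
  obtain ⟨x, hx, hxj⟩ := exists_mem_grid (θ := θ) (u := 1 / 4 + j * t) hh hht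
    (by linarith [hj.1]) (by linarith [hj.2])
  refine ⟨x, hx, ?_⟩
  have hmin := hsel x hx (some j : Option (Fin N))
  have hb := abs_lt.1 hxj
  generalize sel x = f at hmin
  change Option (Fin N) at f
  rcases f with _ | l
  · exact absurd hmin (not_le.2 (clusterInstance_weightedRisk_some_lt ht hNt hε hεt ht1 hx.2.1
      (by linarith [hj.2]) j))
  · erw [clusterInstance_weightedRisk_some, clusterInstance_weightedRisk_some] at hmin
    have h1 : (1 / 4 + l * t - x) ^ 2 ≤ (1 / 4 + j * t - x) ^ 2 := by
      by_contra! hc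
      have := mul_lt_mul_of_pos_left hc hε
      linarith
    have h2 := abs_lt.1 ((sq_le_sq.1 h1).trans_lt hxj)
    -- Both nodes lie strictly within `t / 2` of `x`, and distinct nodes are at least `t` apart.
    have h3 : |((l : ℝ) - j) * t| < 1 * t := by rw [abs_lt]; constructor <;> linarith
    rw [abs_mul, abs_of_pos ht, mul_lt_mul_iff_left₀ ht] at h3
    have h4 : |((l : ℕ) : ℤ) - ((j : ℕ) : ℤ)| < 1 := by exact_mod_cast h3
    rw [Int.abs_lt_one_iff] at h4
    congr 1
    exact Fin.ext (by omega)

lemma clusterInstance_expectedExcessRisk_ge {n : ℕ} {h θ : ℝ} (hh : 0 < h) (hht : h < t)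
    (hN : 0 < N) (hn : 0 < n) (hnt : 8 * Real.log 2 ≤ n * t ^ 2)
    (hB : 8 * Real.exp (2 * (n * t ^ 2)) ≤ N)
    {fhat : (Fin n → (clusterInstance ht hNt hε hεt ht1).Z) → (clusterInstance ht hNt hε hεt ht1).F}
    (hf : (clusterInstance ht hNt hε hεt ht1).IsLMSA
      ({x | ∃ m : ℤ, x = θ + h * m} ∩ Icc (0 : ℝ) 1) fhat) :
    ENNReal.ofReal (t / 128) ≤ (clusterInstance ht hNt hε hεt ht1).expectedExcessRisk fhat := by
  obtain ⟨sel, hsel, -, hERM⟩ := hf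
  have hn' : (0 : ℝ) < n := by exact_mod_cast hn
  let I := clusterInstance ht hNt hε hεt ht1
  have : IsProbabilityMeasure I.Q := I.isProbabilityMeasure_Q
  have htarget (f : Option (Fin N)) : I.targetRisk f = clusterRisk N t ε f 0 := by
    rw [TransferInstance.targetRisk_of_mixture _ (w := 1) ⟨zero_le_one, le_rfl⟩ rfl]
    erw [clusterInstance_sourceRisk]
    ring
  have hgap (j : Fin N) : t / 64 ≤ I.targetRisk (some j : Option (Fin N))
      - I.targetRisk (none : Option (Fin N)) := by
    rw [htarget, htarget]
    have : 0 ≤ ε * (1 - (1 / 4 + (j : ℝ) * t)) ^ 2 := by positivity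
    simp only [clusterRisk, Matrix.cons_val_zero]
    linarith
  have hmin : ∀ f, I.targetRisk (none : Option (Fin N)) ≤ I.targetRisk f := by
    rintro (_ | j)
    · rfl
    · exact (by linarith [hgap j] : I.targetRisk (none : Option (Fin N)) ≤ I.targetRisk (some j : Option (Fin N)))
  let bad : Set (Fin n → Fin 2 × (Fin N → Bool)) :=
    {z | ∀ j, ∑ i, coinSign ((z i).2 j) ≤ n * t / 8}
  have hlaw (g : (Fin N → Bool) → ℝ) : ∫ z : Fin 2 × (Fin N → Bool), g z.2 ∂I.Q
      = ∫ b, g b ∂(coins N) := by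
    have hQ : I.Q = (Measure.dirac 0).prod (coins N) := by
      change ENNReal.ofReal 1 • _ + ENNReal.ofReal (1 - 1) • _ = _
      simp
    rw [hQ, integral_fun_snd]
    simp
  have hbad : (Measure.pi fun _ : Fin n => I.Q).real bad ≤ 1 / 2 :=
    measure_forall_sum_coinSign_lt (Z := I.Z) I.Q (fun z => z.2) measurable_snd hlaw hN ht (by linarith) hnt hB
  have hbadm : MeasurableSet bad := by
    have : bad = ⋂ j, {z | ∑ i, coinSign ((z i).2 j) ≤ n * t / 8} := by
      ext z; simp [bad]
    rw [this]
    refine MeasurableSet.iInter fun j => measurableSet_le ?_ measurable_const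
    refine Finset.measurable_sum _ fun i _ => ?_
    exact (Measurable.of_discrete (f := fun y : Fin N → Bool => coinSign (y j))).comp
      (measurable_snd.comp (measurable_pi_apply i))
  have hgood (z : Fin n → Fin 2 × (Fin N → Bool)) (hz : z ∉ bad) :
      t / 64 ≤ I.excessRisk (fhat z) := by
    simp only [bad, mem_ofPred_eq, not_forall, not_le] at hz
    obtain ⟨j, hj⟩ := hz
    have hmem := clusterInstance_selects_cluster ht hNt hε hεt ht1 hh hht hsel j
    have hle := (hERM z).2 _ hmem
    rw [TransferInstance.excessRisk_eq _ hmin]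
    -- The disadvantage of a cluster member is at most `t / 64 + ε ≤ t / 32`, which is exactly what
    -- signs of mean above `t / 8`, scaled by `1 / 4`, overcome.
    have hloss (x : Fin 2 × (Fin N → Bool)) : I.loss (some j : Option (Fin N)) x
        ≤ I.loss (none : Option (Fin N)) x + (t / 32 - coinSign (x.2 j) / 4) := by
      obtain ⟨k, y⟩ := x
      have hu := cluster_node_mem ht hNt j
      change clusterRisk N t ε (some j) k + clusterNoise N (some j) y
        ≤ clusterRisk N t ε none k + clusterNoise N none y + (t / 32 - coinSign (y j) / 4)
      have h1 : (1 - (1 / 4 + (j : ℝ) * t)) ^ 2 ≤ 1 := by nlinarith [hu.1, hu.2]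
      have h2 : (1 / 4 + (j : ℝ) * t) ^ 2 ≤ 1 := by nlinarith [hu.1, hu.2]
      have h3 := mul_le_mul_of_nonneg_left h1 hε.le
      have h4 := mul_le_mul_of_nonneg_left h2 hε.le
      fin_cases k <;> simp only [clusterRisk, clusterNoise, Fin.zero_eta, Fin.mk_one,
        Matrix.cons_val_zero, Matrix.cons_val_one] <;> linarith
    have hemp : I.empRisk z (some j : Option (Fin N)) < I.empRisk z (none : Option (Fin N)) := by
      unfold TransferInstance.empRisk
      refine mul_lt_mul_of_pos_left ?_ (by positivity)
      exact sum_lt_sum_of_shift _ _ (fun i => coinSign ((z i).2 j)) (fun i => hloss (z i)) hj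
    generalize fhat z = f at hle
    change Option (Fin N) at f
    rcases f with _ | l
    · exact absurd (hle.trans_lt hemp) (lt_irrefl _)
    · exact hgap l
  have hprob : ENNReal.ofReal (1 / 2) ≤ (Measure.pi fun _ : Fin n => I.Q) badᶜ := by
    rw [← ofReal_measureReal, probReal_compl_eq_one_sub hbadm]
    exact ENNReal.ofReal_le_ofReal (by linarith)
  calc ENNReal.ofReal (t / 128) = ENNReal.ofReal (t / 64) * ENNReal.ofReal (1 / 2) := by
        rw [← ENNReal.ofReal_mul (by positivity)]; congr 1; ring
    _ ≤ ENNReal.ofReal (t / 64) * (Measure.pi fun _ : Fin n => I.Q) badᶜ := by gcongr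
    _ = ∫⁻ _ in badᶜ, ENNReal.ofReal (t / 64) ∂(Measure.pi fun _ : Fin n => I.Q) := by
        rw [setLIntegral_const]
    _ ≤ ∫⁻ z in badᶜ, ENNReal.ofReal (I.excessRisk (fhat z)) ∂(Measure.pi fun _ : Fin n => I.Q) :=
        setLIntegral_mono' hbadm.compl fun z hz => ENNReal.ofReal_le_ofReal (hgood z hz)
    _ ≤ _ := setLIntegral_le_lintegral _ _

end clusterInstance

/-! ### Choice of the width -/

/-- The width `√(log n / n) / 3` eventually satisfies the constraints of the construction. -/
lemma eventually_width {t : ℕ → ℝ} (ht : ∀ n, t n = √(Real.log n / n) / 3) :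
    ∀ᶠ n : ℕ in Filter.atTop, 0 < n ∧ 0 < t n ∧ t n ≤ 1 / 4 ∧ 1 / (n : ℝ) ≤ t n / 64 ∧
      8 * Real.log 2 ≤ n * t n ^ 2 ∧
      8 * Real.exp (2 * (n * t n ^ 2)) ≤ (⌊1 / (4 * t n)⌋₊ : ℝ) := by
  have hlog : Filter.Tendsto (fun n : ℕ => Real.log n) Filter.atTop Filter.atTop :=
    Real.tendsto_log_atTop.comp tendsto_natCast_atTop_atTop
  have hlo := ((isLittleO_log_rpow_atTop (r := 1 / 2) (by norm_num)).comp_tendsto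
    (tendsto_natCast_atTop_atTop (R := ℝ))).def (c := 1 / 144) (by norm_num)
  filter_upwards [hlo,
    hlog.eventually_ge_atTop (72 * Real.log 2), hlog.eventually_ge_atTop 1,
    Filter.eventually_ge_atTop 40000] with n hlo hl2 hl1 hn2
  have hn' : (40000 : ℝ) ≤ n := by exact_mod_cast hn2
  have hn0 : (0 : ℝ) < n := by linarith
  simp only [Function.comp, Real.norm_eq_abs] at hlo
  rw [abs_of_nonneg (by linarith), abs_of_nonneg (by positivity), ← Real.sqrt_eq_rpow] at hlo
  have ht2 : (n : ℝ) * t n ^ 2 = Real.log n / 9 := by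
    rw [ht, div_pow, Real.sq_sqrt (by positivity)]; field_simp; norm_num
  have htpos : 0 < t n := by rw [ht]; have : 0 < Real.log n / n := by positivity
                             positivity
  set r := (n : ℝ) ^ (1 / 4 : ℝ) with hr
  have hr0 : 0 < r := by positivity
  have hr2 : √(n : ℝ) = r ^ 2 := by
    rw [Real.sqrt_eq_rpow, hr, ← Real.rpow_natCast, ← Real.rpow_mul hn0.le]; norm_num
  have hr4 : (n : ℝ) = r ^ 4 := by
    rw [hr, ← Real.rpow_natCast, ← Real.rpow_mul hn0.le]; norm_num
  have hr1 : 1 ≤ r := Real.one_le_rpow (by linarith) (by norm_num)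
  -- The factor `1 / 3` in the width gives the exponent `2 / 9`, which is below `1 / 4`. The cluster
  -- size, of order `√(n / log n)`, eventually exceeds `8 r`.
  have hexp : Real.exp (2 * (n * t n ^ 2)) ≤ r := by
    rw [ht2, hr, Real.rpow_def_of_pos hn0]
    exact Real.exp_le_exp.2 (by linarith)
  have htr : t n * r ≤ 1 / 36 := by
    refine abs_le_of_sq_le_sq' ?_ (by norm_num) |>.2
    have h1 : r ^ 2 * (t n * r) ^ 2 ≤ r ^ 2 * (1 / 36) ^ 2 := by
      calc r ^ 2 * (t n * r) ^ 2 = n * t n ^ 2 := by rw [hr4]; ring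
        _ ≤ _ := by rw [ht2]; linarith
    exact le_of_mul_le_mul_left h1 (by positivity)
  refine ⟨by omega, htpos, by nlinarith, ?_, by rw [ht2]; linarith, ?_⟩
  · have h1 : 64 ≤ n * t n := by
      refine abs_le_of_sq_le_sq' ?_ (by positivity) |>.2
      have : ((n : ℝ) * t n) ^ 2 = n * (Real.log n / 9) := by rw [← ht2]; ring
      rw [this]; nlinarith
    rw [div_le_div_iff₀ hn0 (by norm_num)]; linarith
  · have h1 := Nat.lt_floor_add_one (1 / (4 * t n))
    -- The ninth `r`, which is at least `1`, pays for the rounding in the floor.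
    have h2 : 9 * r ≤ 1 / (4 * t n) := by
      rw [le_div_iff₀ (by positivity)]; linarith
    linarith

end

/-! ### The separation -/

theorem mainTheorem8 :
    ∃ c C : ℝ, 0 < c ∧ 0 < C ∧ ∀ᶠ n : ℕ in Filter.atTop, ∃ 𝒞 : Set TransferInstance,
      -- every target is an exact mixture of the two sources
      (∀ I ∈ 𝒞, ∃ w ∈ Icc (0 : ℝ) 1,
        I.Q = ENNReal.ofReal w • I.P 0 + ENNReal.ofReal (1 - w) • I.P 1 ∧
        ∀ f, I.targetRisk f = w * I.sourceRisk f 0 + (1 - w) * I.sourceRisk f 1) ∧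
      -- every point of the Pareto front is supported by a weighted sum
      (∀ I ∈ 𝒞, ∀ r ∈ I.paretoFront, I.IsSupported r) ∧
      -- lower bound for LMSA with the best grid, whatever the tie-breaking rules
      (∀ fhat : ∀ (_ : Set ℝ) (I : TransferInstance), (Fin n → I.Z) → I.F,
        (∀ Λ ∈ uniformGrids, ∀ I ∈ 𝒞, I.IsLMSA Λ (fhat Λ I)) →
        ENNReal.ofReal (c * √(Real.log n / n)) ≤
          ⨅ Λ ∈ uniformGrids, ⨆ I ∈ 𝒞, I.expectedExcessRisk (fhat Λ I)) ∧
      -- upper bound for Pareto ERM at scale 1/n, whatever the minimal Pareto sets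
      (∀ fhat : ∀ I : TransferInstance, (Fin n → I.Z) → I.F,
        (∀ I ∈ 𝒞, I.IsParetoERM (1 / (n : ℝ)) (fhat I)) →
        ⨆ I ∈ 𝒞, I.expectedExcessRisk (fhat I) ≤ ENNReal.ofReal (C / √(n : ℝ))) := by
  refine ⟨1 / 384, 7, by norm_num, by norm_num, ?_⟩
  filter_upwards [eventually_width (t := fun n => √(Real.log n / n) / 3) fun _ => rfl] with n hn
  generalize ht_def : √(Real.log n / n) / 3 = t at hn
  obtain ⟨hn, ht, ht1, hnt, hlog, hB⟩ := hn
  have hn' : (0 : ℝ) < n := by exact_mod_cast hn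
  have hε : 0 < 1 / (n : ℝ) := by positivity
  set N := ⌊1 / (4 * t)⌋₊
  have hN : 0 < N := by
    have := Real.exp_pos (2 * (n * t ^ 2))
    exact_mod_cast (by linarith : (0 : ℝ) < N)
  have hNt : N * t ≤ 1 / 4 := by
    have := Nat.floor_le (show 0 ≤ 1 / (4 * t) by positivity)
    calc N * t ≤ 1 / (4 * t) * t := by gcongr
      _ = 1 / 4 := by field_simp
  have hs : 0 < t / 8 := by positivity
  let K₁ := kinkInstance (v := 1 / 2) (s := t / 8) hs (by linarith) (by linarith)
  let K₂ := kinkInstance (v := 1 / 2 + t / 2) (s := t / 8) hs (by linarith) (by linarith)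
  let L := clusterInstance ht hNt hε hnt ht1
  have easy : ∀ I ∈ ({K₁, K₂, L} : Set TransferInstance), I.IsEasy (1 / (n : ℝ)) := by
    rintro I (rfl | rfl | rfl)
    · exact kinkInstance_isEasy _ _ _ hε.le
    · exact kinkInstance_isEasy _ _ _ hε.le
    · exact clusterInstance_isEasy ht hNt hε hnt ht1 hN
  refine ⟨{K₁, K₂, L}, ?_, fun I hI r hr => (easy I hI).isSupported hr, ?_, ?_⟩
  · intro I hI
    obtain ⟨w, hw, hQ⟩ := (easy I hI).1
    exact ⟨w, hw, hQ, I.targetRisk_of_mixture hw hQ⟩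
  · intro fhat hfhat
    refine le_iInf₂ fun Λ hΛ => ?_
    have hL := hfhat Λ hΛ
    have hc : 1 / 384 * √(Real.log n / n) = t / 128 := by rw [← ht_def]; ring
    have hc' : ENNReal.ofReal (t / 128) ≤ ENNReal.ofReal (t / 8 / 4) :=
      ENNReal.ofReal_le_ofReal (by linarith)
    rw [hc]
    obtain ⟨h, θ, hh, -, -, -, rfl⟩ := hΛ
    -- The instance that defeats the grid depends only on the grid: fine grids fail on `L`, coarse
    -- ones on `K₁` or `K₂`.
    rcases lt_or_ge h t with hht | hht
    · exact (clusterInstance_expectedExcessRisk_ge ht hNt hε hnt ht1 hh hht hN hn hlog hB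
        (hL L (by simp))).trans (le_iSup₂ (f := fun I (_ : I ∈ ({K₁, K₂, L} : Set TransferInstance)) =>
          I.expectedExcessRisk (fhat _ I)) L (by simp))
    -- Points of the two intervals are between `t / 4` and `3 t / 4 < h` apart, so they cannot both
    -- be grid points.
    · rcases grid_gap (θ := θ) (v := 1 / 2) (s := t / 8) (d := t / 2) hh (by linarith)
        (by linarith) with hgap | hgap
      · exact hc'.trans ((kinkInstance_expectedExcessRisk_ge _ _ _ hgap (hL K₁ (by simp))).trans
          (le_iSup₂ (f := fun I (_ : I ∈ ({K₁, K₂, L} : Set TransferInstance)) =>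
            I.expectedExcessRisk (fhat _ I)) K₁ (by simp)))
      · exact hc'.trans ((kinkInstance_expectedExcessRisk_ge _ _ _ hgap (hL K₂ (by simp))).trans
          (le_iSup₂ (f := fun I (_ : I ∈ ({K₁, K₂, L} : Set TransferInstance)) =>
            I.expectedExcessRisk (fhat _ I)) K₂ (by simp)))
  · intro fhat hfhat
    exact iSup₂_le fun I hI => (easy I hI).expectedExcessRisk_le hn (hfhat I hI)
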